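/- Let $A,B,C$ be quantum systems with finite-dimensional Hilbert spaces $\mathbb{C}_A,\mathbb{C}_B,\mathbb{C}_C$. Let $\rho_{ABC}$ be a density matrix (positive semidefinite, trace one) on $\mathbb{C}_A\otimes\mathbb{C}_B\otimes\mathbb{C}_C$, with reduced states $\rho_{AB}=\mathrm{Tr}_C\,\rho_{ABC}$, $\rho_{AC}=\mathrm{Tr}_B\,\rho_{ABC}$ and $\rho_A=\mathrm{Tr}_{BC}\,\rho_{ABC}$. Let $S(\rho)=-\mathrm{Tr}[\rho\log_2\rho]$ (with $0\log_2 0=0$) be the von Neumann entropy and $I(X:Y)_{\sigma_{XY}}=S(\sigma_X)+S(\sigma_Y)-S(\sigma_{XY})$ the mutual information. Let $$E_f(\rho_{AB})=\min\sum_i p_i\,S\big(\mathrm{Tr}_B|\psi_i\rangle\langle\psi_i|\big)$$ be the entanglement of formation, where the minimum is over all finite ensembles of unit vectors $|\psi_i\rangle\in\mathbb{C}_A\otimes\mathbb{C}_B$ and probabilities $p_i\ge 0$, $\sum_i p_i=1$, with $\rho_{AB}=\sum_i p_i|\psi_i\rangle\langle\psi_i|$. Let $$J(A:C)_{\rho_{AC}}=\max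 I(A:X)_{\sigma_{AX}},\qquad \sigma_{AX}=\sum_x \mathrm{Tr}_C\big[(\mathbb{I}_A\otimes M_x)\rho_{AC}\big]\otimes|x\rangle\langle x|,$$ be the classical correlations, where the maximum is over all POVMs $\{M_x\}_x$ on $\mathbb{C}_C$ with finitely many outcomes (positive semidefinite $M_x$ with $\sum_x M_x=\mathbb{I}_C$). Then the minimum defining $E_f(\rho_{AB})$ and the maximum defining $J(A:C)_{\rho_{AC}}$ are attained, and $$E_f(\rho_{AB})+J(A:C)_{\rho_{AC}}\le S(\rho_A).$$ If $\rho_{ABC}$ is pure ($\rho_{ABC}=\rho_{ABC}^2$), equality holds. -/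

import Mathlib

open Matrix
open scoped Kronecker ComplexOrder

noncomputable section

namespace QInfo

/-- A density matrix on the Hilbert space `ℂ^n` (with `n` a finite index type): a positive
semidefinite (in particular Hermitian) matrix of trace one. -/
structure IsDensityMatrix {n : Type*} [Fintype n] (ρ : Matrix n n ℂ) : Prop where
  posSemidef : ρ.PosSemidef
  trace_eq_one : ρ.trace = 1

/-- A density matrix is pure when `ρ = ρ²`. -/
def IsPure {n : Type*} [Fintype n] (ρ : Matrix n n ℂ) : Prop :=
  ρ = ρ * ρ

/-- Partial trace over the right tensor factor, `ρ_{XY} ↦ Tr_Y[ρ_{XY}] = ρ_X`. -/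
def traceRight {x y : Type*} [Fintype y] (ρ : Matrix (x × y) (x × y) ℂ) : Matrix x x ℂ :=
  Matrix.of fun i j => ∑ k, ρ (i, k) (j, k)

/-- Partial trace over the left tensor factor, `ρ_{XY} ↦ Tr_X[ρ_{XY}] = ρ_Y`. -/
def traceLeft {x y : Type*} [Fintype x] (ρ : Matrix (x × y) (x × y) ℂ) : Matrix y y ℂ :=
  Matrix.of fun i j => ∑ k, ρ (k, i) (k, j)

/-- The marginal `ρ_A = Tr_{BC}[ρ_{ABC}]`. -/
def marginalA {a b c : Type*} [Fintype b] [Fintype c]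
    (ρ : Matrix (a × b × c) (a × b × c) ℂ) : Matrix a a ℂ :=
  traceRight ρ

/-- The marginal `ρ_{AB} = Tr_C[ρ_{ABC}]`. -/
def marginalAB {a b c : Type*} [Fintype c]
    (ρ : Matrix (a × b × c) (a × b × c) ℂ) : Matrix (a × b) (a × b) ℂ :=
  Matrix.of fun i j => ∑ k, ρ (i.1, i.2, k) (j.1, j.2, k)

/-- The marginal `ρ_{AC} = Tr_B[ρ_{ABC}]`. -/
def marginalAC {a b c : Type*} [Fintype b]
    (ρ : Matrix (a × b × c) (a × b × c) ℂ) : Matrix (a × c) (a × c) ℂ :=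
  Matrix.of fun i j => ∑ k, ρ (i.1, k, i.2) (j.1, k, j.2)

/-- The von Neumann entropy `S(ρ) = -Tr[ρ log₂ ρ]`, with `log₂ ρ` given by the functional calculus
of the Hermitian matrix `ρ`. The value `Real.logb 2 0 = 0` gives `0 log₂ 0 = 0`. -/
def entropy {n : Type*} [Fintype n] [DecidableEq n] (ρ : Matrix n n ℂ) : ℝ :=
  -((ρ * cfc (Real.logb 2) ρ).trace).re

/-- The quantum mutual information `I(X:Y) = S(ρ_X) + S(ρ_Y) - S(ρ_{XY})`. -/
def mutualInfo {x y : Type*} [Fintype x] [DecidableEq x] [Fintype y] [DecidableEq y]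
    (ρ : Matrix (x × y) (x × y) ℂ) : ℝ :=
  entropy (traceRight ρ) + entropy (traceLeft ρ) - entropy ρ

/-- The projector `|ψ⟩⟨ψ|`. -/
def ketbra {n : Type*} (ψ : n → ℂ) : Matrix n n ℂ :=
  Matrix.vecMulVec ψ (star ψ)

/-- The entropy of entanglement `E(|ψ⟩) = S(Tr_Y |ψ⟩⟨ψ|)` of a vector of `ℂ^x ⊗ ℂ^y`. -/
def entanglementEntropy {x y : Type*} [Fintype x] [DecidableEq x] [Fintype y]
    (ψ : x × y → ℂ) : ℝ :=
  entropy (traceRight (ketbra ψ))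

/-- `{p_i, |ψ_i⟩⟨ψ_i|}` is an ensemble of pure states realizing `ρ`. -/
structure IsPureEnsemble {n : Type*} [Fintype n] {m : ℕ} (p : Fin m → ℝ) (ψ : Fin m → n → ℂ)
    (ρ : Matrix n n ℂ) : Prop where
  nonneg : ∀ i, 0 ≤ p i
  sum_eq_one : ∑ i, p i = 1
  normalized : ∀ i, ∑ k, ‖ψ i k‖ ^ 2 = 1
  realizes : ρ = ∑ i, (p i : ℂ) • ketbra (ψ i)

/-- All average entanglement entropies `∑ p_i E(|ψ_i⟩)` of finite pure-state ensembles of `ρ`. -/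
def formationValues {x y : Type*} [Fintype x] [DecidableEq x] [Fintype y]
    (ρ : Matrix (x × y) (x × y) ℂ) : Set ℝ :=
  {v | ∃ (m : ℕ) (p : Fin m → ℝ) (ψ : Fin m → x × y → ℂ),
    IsPureEnsemble p ψ ρ ∧ v = ∑ i, p i * entanglementEntropy (ψ i)}

/-- The entanglement of formation `E_f(ρ)`. -/
def entanglementOfFormation {x y : Type*} [Fintype x] [DecidableEq x] [Fintype y]
    (ρ : Matrix (x × y) (x × y) ℂ) : ℝ :=
  sInf (formationValues ρ)

/-- A POVM on `ℂ^n` with `m` outcomes. -/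
structure IsPOVM {n : Type*} [Fintype n] [DecidableEq n] {m : ℕ}
    (M : Fin m → Matrix n n ℂ) : Prop where
  posSemidef : ∀ k, (M k).PosSemidef
  sum_eq_one : ∑ k, M k = 1

/-- The state after the local measurement `M` of the second factor:
`(𝕀 ⊗ M)(ρ) = ∑_k Tr_Y[(𝕀 ⊗ M_k) ρ] ⊗ |k⟩⟨k|`. -/
def measureRight {x y : Type*} [Fintype x] [DecidableEq x] [Fintype y] {m : ℕ}
    (M : Fin m → Matrix y y ℂ) (ρ : Matrix (x × y) (x × y) ℂ) :
    Matrix (x × Fin m) (x × Fin m) ℂ :=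
  ∑ k, traceRight (((1 : Matrix x x ℂ) ⊗ₖ M k) * ρ) ⊗ₖ Matrix.single k k (1 : ℂ)

/-- All mutual informations of states obtained from `ρ` by a POVM with finitely many outcomes on the
second factor. -/
def measuredInfoValues {x y : Type*} [Fintype x] [DecidableEq x] [Fintype y] [DecidableEq y]
    (ρ : Matrix (x × y) (x × y) ℂ) : Set ℝ :=
  {v | ∃ (m : ℕ) (M : Fin m → Matrix y y ℂ), IsPOVM M ∧ v = mutualInfo (measureRight M ρ)}

/-- The classical correlations `J(X:Y)_ρ`, with the measurement on `Y`. -/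
def classicalCorrelations {x y : Type*} [Fintype x] [DecidableEq x] [Fintype y] [DecidableEq y]
    (ρ : Matrix (x × y) (x × y) ℂ) : ℝ :=
  sSup (measuredInfoValues ρ)

end QInfo

end

/-! Measuring C leaves AB in unnormalised conditional states, whose partial traces τ_k are the
conditional states of A. The resulting state of AX is block diagonal, so I(A:X) = S(ρ_A) − Σ h(τ_k),
with h the homogeneous entropy `weightedEntropy` (`mutualInfo_measureRight`). Hence J is S(ρ_A)
minus the least mean conditional entropy over POVMs on C, and the theorem compares that minimum with
E_f.

Inequality: split each conditional state of AB into pure vectors. Together they decompose ρ_AB, and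
concavity of entropy (`sum_weightedEntropy_le`) bounds their mean entanglement by Σ h(τ_k). An
optimal POVM thus yields an ensemble at least as good (`exists_formationValue_le`).

Equality: for a pure state, ρ_AB = T Tᴴ with T the coefficient matrix from C to AB. Every ensemble
of ρ_AB then comes from a measurement on C (`exists_resolution_of_sum_eq`), so an optimal ensemble
gives a POVM with the same mean.

Attainment: both problems average a continuous function over convex decompositions of a fixed point
into points of a compact set. The averages form a slice of the convex hull of a compact graph
(`isCompact_convexAverages`). -/

namespace QInfo

/-! ### Compactness of convex hulls and of sets of convex averages -/

section ConvexHull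

/-- The convex hull of a compact set in a finite-dimensional space is compact. -/
theorem isCompact_convexHull {E : Type*} [AddCommGroup E] [Module ℝ E] [TopologicalSpace E]
    [ContinuousAdd E] [ContinuousSMul ℝ E] [FiniteDimensional ℝ E] {s : Set E} (hs : IsCompact s) :
    IsCompact (convexHull ℝ s) := by
  -- Carathéodory: affinely independent points number at most `finrank + 1`, so finitely many
  -- simplices suffice.
  have key : convexHull ℝ s = ⋃ N ∈ Set.Iic (Module.finrank ℝ E + 1),
      (fun q : (Fin N → ℝ) × (Fin N → E) => ∑ i, q.1 i • q.2 i) ''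
        (stdSimplex ℝ (Fin N) ×ˢ Set.univ.pi fun _ => s) := by
    apply Set.Subset.antisymm
    · rw [convexHull_eq_union]
      simp only [Set.iUnion_subset_iff]
      intro t hts hind x hx
      rw [Finset.convexHull_eq] at hx
      obtain ⟨w, hw0, hw1, rfl⟩ := hx
      refine Set.mem_biUnion (x := t.card) ?_ ?_
      · have h1 := hind.card_le_finrank_succ
        have h2 := Submodule.finrank_le (vectorSpan ℝ (Set.range ((↑) : t → E)))
        simp only [Fintype.card_coe] at h1
        simp only [Set.mem_Iic]
        omega
      · let e := t.equivFin.symm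
        refine ⟨⟨fun i => w (e i), fun i => (e i : E)⟩, ⟨⟨fun i => hw0 _ (e i).2, ?_⟩, ?_⟩, ?_⟩
        · simp only
          rw [e.sum_comp (fun y : t => w y), Finset.sum_coe_sort t w, hw1]
        · exact fun i _ => hts (e i).2
        · simp only
          rw [Finset.centerMass_eq_of_sum_1 _ _ hw1, e.sum_comp (fun y : t => w y • (y : E)),
            Finset.sum_coe_sort t (fun y => w y • y)]
          rfl
    · simp only [Set.iUnion_subset_iff]
      rintro N - _ ⟨⟨w, z⟩, ⟨hw, hz⟩, rfl⟩
      exact mem_convexHull_of_exists_fintype w z hw.1 hw.2 (fun i => hz i trivial) rfl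
  rw [key]
  refine (Set.finite_Iic _).isCompact_biUnion fun N _ => ?_
  refine ((isCompact_stdSimplex ℝ (Fin N)).prod (isCompact_univ_pi fun _ => hs)).image ?_
  fun_prop

/-- The averages `∑ wᵢ f(zᵢ)` over all finite convex decompositions `x = ∑ wᵢ zᵢ` into points of
`s`. -/
def convexAverages {E : Type*} [AddCommGroup E] [Module ℝ E] (s : Set E) (f : E → ℝ) (x : E) :
    Set ℝ :=
  {v | ∃ (m : ℕ) (w : Fin m → ℝ) (z : Fin m → E), (∀ i, 0 ≤ w i) ∧ ∑ i, w i = 1 ∧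
    (∀ i, z i ∈ s) ∧ ∑ i, w i • z i = x ∧ v = ∑ i, w i * f (z i)}

theorem isCompact_convexAverages {E : Type*} [AddCommGroup E] [Module ℝ E] [TopologicalSpace E]
    [T1Space E] [ContinuousAdd E] [ContinuousSMul ℝ E] [FiniteDimensional ℝ E] {s : Set E}
    {f : E → ℝ} (hs : IsCompact s) (hf : ContinuousOn f s) (x : E) :
    IsCompact (convexAverages s f x) := by
  have hK : IsCompact (convexHull ℝ ((fun z => (z, f z)) '' s)) :=
    isCompact_convexHull (hs.image_of_continuousOn (continuousOn_id.prodMk hf))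
  -- Averages of `f` are the heights over `x` of the convex hull of the graph of `f`.
  have : convexAverages s f x =
      Prod.snd '' (convexHull ℝ ((fun z => (z, f z)) '' s) ∩ Prod.fst ⁻¹' {x}) := by
    ext v
    constructor
    · rintro ⟨m, w, z, hw0, hw1, hz, hx, rfl⟩
      refine ⟨(x, ∑ i, w i * f (z i)), ⟨?_, rfl⟩, rfl⟩
      refine mem_convexHull_of_exists_fintype w (fun i => (z i, f (z i))) hw0 hw1
        (fun i => ⟨z i, hz i, rfl⟩) ?_
      ext1
      · simpa [Prod.fst_sum] using hx
      · simp [Prod.snd_sum]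
    · rintro ⟨⟨y, u⟩, ⟨hy, hyx⟩, rfl⟩
      obtain ⟨ι, _, w, z, hw0, hw1, hz, hsum⟩ := mem_convexHull_iff_exists_fintype.1 hy
      choose z' hz' hzz using hz
      obtain rfl : y = x := hyx
      let e := (Fintype.equivFin ι).symm
      refine ⟨Fintype.card ι, w ∘ e, z' ∘ e, fun i => hw0 _, ?_, fun i => hz' _, ?_, ?_⟩
      · rw [← hw1]; exact e.sum_comp w
      · refine (e.sum_comp fun i => w i • z' i).trans ?_
        have := congrArg Prod.fst hsum
        simpa [Prod.fst_sum, ← hzz] using this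
      · refine Eq.symm ((e.sum_comp fun i => w i * f (z' i)).trans ?_)
        have := congrArg Prod.snd hsum
        simpa [Prod.snd_sum, ← hzz] using this
  rw [this]
  exact (hK.inter_right (isClosed_singleton.preimage continuous_fst)).image continuous_snd

end ConvexHull

/-! ### Von Neumann entropy: spectral formula, continuity, diagonal bound -/

section Entropy

/-- The function `-x log₂ x`. -/
noncomputable def negMulLogTwo (x : ℝ) : ℝ := Real.negMulLog x / Real.log 2

theorem continuous_negMulLogTwo : Continuous negMulLogTwo :=
  Real.continuous_negMulLog.div_const _

@[simp] theorem negMulLogTwo_zero : negMulLogTwo 0 = 0 := by simp [negMulLogTwo]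

@[simp] theorem negMulLogTwo_one : negMulLogTwo 1 = 0 := by simp [negMulLogTwo]

theorem negMulLogTwo_mul (x y : ℝ) :
    negMulLogTwo (x * y) = y * negMulLogTwo x + x * negMulLogTwo y := by
  simp only [negMulLogTwo, Real.negMulLog_mul]; ring

theorem concaveOn_negMulLogTwo : ConcaveOn ℝ (Set.Ici (0 : ℝ)) negMulLogTwo := by
  have := Real.concaveOn_negMulLog.smul (c := (Real.log 2)⁻¹) (by positivity)
  refine this.congr fun x _ => ?_
  simp [negMulLogTwo, div_eq_inv_mul]

variable {n : Type*} [Fintype n] [DecidableEq n]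

theorem trace_cfc {A : Matrix n n ℂ} (hA : A.IsHermitian) (f : ℝ → ℝ) :
    (cfc f A).trace = ∑ i, (f (hA.eigenvalues i) : ℂ) := by
  rw [hA.cfc_eq, IsHermitian.cfc, Unitary.conjStarAlgAut_apply, trace_mul_comm, ← mul_assoc]
  simp [trace_diagonal]

/-- Absorbing the factor `A` replaces the logarithm, singular at 0, by a function continuous on all
of ℝ; this is what makes entropy continuous at singular matrices. The spectrum being finite, every
function is continuous on it and `cfc_mul` applies. -/
theorem entropy_eq_trace_cfc {A : Matrix n n ℂ} (hA : A.IsHermitian) :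
    entropy A = (cfc negMulLogTwo A).trace.re := by
  have h : A * cfc (Real.logb 2) A = cfc (fun x => x * Real.logb 2 x) A := by
    have hfin := A.finite_real_spectrum
    rw [cfc_mul (fun x : ℝ => x) (Real.logb 2) A (by fun_prop) (hfin.continuousOn _),
      cfc_id' ℝ A hA.isSelfAdjoint]
  rw [entropy, h, trace_cfc hA, trace_cfc hA]
  simp only [← Complex.ofReal_sum, Complex.ofReal_re, ← Finset.sum_neg_distrib]
  refine Finset.sum_congr rfl fun i _ => ?_
  simp only [negMulLogTwo, Real.negMulLog, Real.logb]; ring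

theorem entropy_eq_sum_eigenvalues {A : Matrix n n ℂ} (hA : A.IsHermitian) :
    entropy A = ∑ i, negMulLogTwo (hA.eigenvalues i) := by
  rw [entropy_eq_trace_cfc hA, trace_cfc hA, ← Complex.ofReal_sum, Complex.ofReal_re]

open scoped Matrix.Norms.L2Operator in
theorem continuousOn_entropy :
    ContinuousOn (entropy (n := n)) {A | A.IsHermitian} := by
  have h : ContinuousOn (fun A : Matrix n n ℂ => cfc negMulLogTwo A) {A | A.IsHermitian} :=
    ContinuousOn.cfc_of_mem_nhdsSet (s := Set.univ) negMulLogTwo Filter.univ_mem continuousOn_id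
      (fun A hA => hA.isSelfAdjoint) continuous_negMulLogTwo.continuousOn
  have h2 : ContinuousOn (fun A : Matrix n n ℂ => (cfc negMulLogTwo A).trace.re)
      {A | A.IsHermitian} :=
    (Complex.continuous_re.comp (continuous_id.matrix_trace)).comp_continuousOn h
  exact h2.congr fun A hA => entropy_eq_trace_cfc hA

theorem isHermitian_conj_diagonal (U : Matrix n n ℂ) (d : n → ℝ) :
    (U * diagonal (fun i => (d i : ℂ)) * Uᴴ).IsHermitian :=
  isHermitian_mul_mul_conjTranspose _
    (isHermitian_diagonal_of_self_adjoint _ (by ext; simp))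

/-- The characteristic polynomial is that of the diagonal, so the eigenvalues agree with `d` as a
multiset and no ordering has to be matched. -/
theorem entropy_conj_diagonal {U : Matrix n n ℂ} (hU : Uᴴ * U = 1) (d : n → ℝ) :
    entropy (U * diagonal (fun i => (d i : ℂ)) * Uᴴ) = ∑ i, negMulLogTwo (d i) := by
  have hB := isHermitian_conj_diagonal U d
  rw [entropy_eq_sum_eigenvalues hB]
  have h1 := hB.roots_charpoly_eq_eigenvalues
  rw [charpoly_mul_comm, ← mul_assoc, hU, one_mul, charpoly_diagonal, Polynomial.roots_prod _ _
    (by simp [Finset.prod_ne_zero_iff, Polynomial.X_sub_C_ne_zero])] at h1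
  have h2 := congrArg (Multiset.map (fun z : ℂ => negMulLogTwo z.re)) h1
  simp only [Polynomial.roots_X_sub_C, Multiset.bind_singleton, Multiset.map_map] at h2
  have h3 := congrArg Multiset.sum h2
  simpa using! h3.symm

theorem exists_unitary_diagonalization {A : Matrix n n ℂ} (hA : A.IsHermitian) :
    ∃ U : Matrix n n ℂ, Uᴴ * U = 1 ∧ U * Uᴴ = 1 ∧
      A = U * diagonal (fun i => (hA.eigenvalues i : ℂ)) * Uᴴ := by
  refine ⟨hA.eigenvectorUnitary, ?_, ?_, ?_⟩
  · exact Unitary.coe_star_mul_self hA.eigenvectorUnitary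
  · exact Unitary.coe_mul_star_self hA.eigenvectorUnitary
  · conv_lhs => rw [hA.spectral_theorem]
    rfl

theorem entropy_conj {A U : Matrix n n ℂ} (hA : A.IsHermitian) (hU : Uᴴ * U = 1) :
    entropy (U * A * Uᴴ) = entropy A := by
  obtain ⟨V, hV, -, h⟩ := exists_unitary_diagonalization hA
  have h1 : U * A * Uᴴ = (U * V) * diagonal (fun i => (hA.eigenvalues i : ℂ)) * (U * V)ᴴ := by
    conv_lhs => rw [h]
    simp only [conjTranspose_mul, mul_assoc]
  rw [h1, entropy_conj_diagonal, entropy_eq_sum_eigenvalues hA]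
  rw [conjTranspose_mul, mul_assoc, ← mul_assoc Uᴴ, hU, one_mul, hV]

theorem entropy_diagonal (d : n → ℝ) :
    entropy (diagonal fun i => (d i : ℂ)) = ∑ i, negMulLogTwo (d i) := by
  simpa using entropy_conj_diagonal (U := 1) (by simp) d

theorem entropy_smul {A : Matrix n n ℂ} (hA : A.IsHermitian) (t : ℝ) :
    entropy ((t : ℂ) • A) = t * entropy A + negMulLogTwo t * A.trace.re := by
  obtain ⟨U, hU, -, h⟩ := exists_unitary_diagonalization hA
  have h1 : (t : ℂ) • A = U * diagonal (fun i => ((t * hA.eigenvalues i : ℝ) : ℂ)) * Uᴴ := by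
    conv_lhs => rw [h]
    rw [← smul_mul_assoc, ← mul_smul_comm, ← diagonal_smul]
    congr 3
    ext; simp
  rw [h1, entropy_conj_diagonal hU, entropy_eq_sum_eigenvalues hA, hA.trace_eq_sum_eigenvalues]
  simp only [negMulLogTwo_mul, Finset.sum_add_distrib, Finset.mul_sum, Complex.coe_algebraMap,
    Complex.re_sum, Complex.ofReal_re]
  rw [add_comm]
  exact congrArg₂ _ rfl (Finset.sum_congr rfl fun i _ => mul_comm _ _)

theorem entropy_blockDiagonal {o : Type*} [Fintype o] [DecidableEq o] {τ : o → Matrix n n ℂ}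
    (hτ : ∀ k, (τ k).IsHermitian) : entropy (blockDiagonal τ) = ∑ k, entropy (τ k) := by
  choose U hU _ h using fun k => exists_unitary_diagonalization (hτ k)
  have h1 : blockDiagonal τ = blockDiagonal U *
      diagonal (fun i : n × o => (((hτ i.2).eigenvalues i.1 : ℝ) : ℂ)) * (blockDiagonal U)ᴴ := by
    rw [blockDiagonal_conjTranspose,
      ← blockDiagonal_diagonal (fun k i => (((hτ k).eigenvalues i : ℝ) : ℂ)),
      ← blockDiagonal_mul, ← blockDiagonal_mul]
    congr 1
    funext k
    exact h k
  rw [h1, entropy_conj_diagonal, Fintype.sum_prod_type_right]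
  · exact Finset.sum_congr rfl fun k _ => (entropy_eq_sum_eigenvalues (hτ k)).symm
  · rw [blockDiagonal_conjTranspose, ← blockDiagonal_mul]
    simp [hU, ← Pi.one_def]

/-- The entropy of a positive semidefinite matrix is at most that of its diagonal. -/
theorem entropy_le_sum_diag {A : Matrix n n ℂ} (hA : A.PosSemidef) :
    entropy A ≤ ∑ i, negMulLogTwo (A i i).re := by
  obtain ⟨U, hU, hU', h⟩ := exists_unitary_diagonalization hA.isHermitian
  set d := hA.isHermitian.eigenvalues with hd
  have hd0 : ∀ j, 0 ≤ d j := hA.eigenvalues_nonneg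
  -- The diagonal is the image of the spectrum under the doubly stochastic matrix |U_ij|²: row sums
  -- allow Jensen, column sums recover the entropy.
  have hdiag : ∀ i, (A i i).re = ∑ j, Complex.normSq (U i j) * d j := by
    intro i
    conv_lhs => rw [h]
    rw [mul_apply, Complex.re_sum]
    refine Finset.sum_congr rfl fun j _ => ?_
    rw [mul_diagonal, conjTranspose_apply, mul_right_comm, ← starRingEnd_apply, Complex.mul_conj,
      ← Complex.ofReal_mul, Complex.ofReal_re]
  have hrow : ∀ i, ∑ j, Complex.normSq (U i j) = 1 := by
    intro i
    have := congrFun (congrFun hU' i) i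
    simp only [mul_apply, conjTranspose_apply, ← starRingEnd_apply, Complex.mul_conj,
      one_apply_eq] at this
    exact_mod_cast this
  have hcol : ∀ j, ∑ i, Complex.normSq (U i j) = 1 := by
    intro j
    have := congrFun (congrFun hU j) j
    simp only [mul_apply, conjTranspose_apply, ← starRingEnd_apply, mul_comm (starRingEnd ℂ _),
      Complex.mul_conj, one_apply_eq] at this
    exact_mod_cast this
  calc entropy A = ∑ j, negMulLogTwo (d j) := entropy_eq_sum_eigenvalues hA.isHermitian
    _ = ∑ i, ∑ j, Complex.normSq (U i j) * negMulLogTwo (d j) := by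
        rw [Finset.sum_comm]
        simp_rw [← Finset.sum_mul, hcol, one_mul]
    _ ≤ ∑ i, negMulLogTwo (A i i).re := by
        refine Finset.sum_le_sum fun i _ => ?_
        rw [hdiag]
        simpa using concaveOn_negMulLogTwo.le_map_sum (t := Finset.univ)
          (w := fun j => Complex.normSq (U i j)) (p := d)
          (fun j _ => Complex.normSq_nonneg _) (hrow i) (fun j _ => hd0 j)

end Entropy

/-! ### Log-sum inequality and concavity of entropy in homogeneous form -/

section WeightedEntropy

/-- Both sides are the Shannon entropy of the normalised vector times its total mass; this form lets
the log-sum inequality act on each coordinate separately. -/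
theorem sum_negMulLogTwo_sub {ι : Type*} (s : Finset ι) {x : ι → ℝ} (hx : ∀ i ∈ s, 0 ≤ x i) :
    ∑ i ∈ s, negMulLogTwo (x i) - negMulLogTwo (∑ i ∈ s, x i) =
      ∑ i ∈ s, (∑ i ∈ s, x i) * negMulLogTwo (x i / ∑ i ∈ s, x i) := by
  set X := ∑ i ∈ s, x i with hX
  rcases eq_or_ne X 0 with h | h
  · have h0 := (Finset.sum_eq_zero_iff_of_nonneg hx).1 (hX ▸ h)
    rw [Finset.sum_eq_zero fun i hi => by rw [h0 i hi, negMulLogTwo_zero]]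
    simp [h]
  · have hinv : X * negMulLogTwo X⁻¹ = - X⁻¹ * negMulLogTwo X := by
      have := negMulLogTwo_mul X X⁻¹
      rw [mul_inv_cancel₀ h, negMulLogTwo_one] at this
      linarith
    simp only [div_eq_mul_inv, negMulLogTwo_mul, mul_add, Finset.sum_add_distrib]
    have e1 : ∀ i ∈ s, X * (X⁻¹ * negMulLogTwo (x i)) = negMulLogTwo (x i) := fun i _ => by
      rw [mul_inv_cancel_left₀ h]
    have e2 : ∀ i ∈ s, X * (x i * negMulLogTwo X⁻¹) = x i * (- X⁻¹ * negMulLogTwo X) :=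
      fun i _ => by rw [mul_left_comm, hinv]
    rw [Finset.sum_congr rfl e1, Finset.sum_congr rfl e2, ← Finset.sum_mul, ← hX]
    field_simp
    ring

/-- The log-sum inequality. -/
theorem sum_mul_negMulLogTwo_div_le {ι : Type*} (s : Finset ι) {x X : ι → ℝ}
    (hx : ∀ i ∈ s, 0 ≤ x i) (hxX : ∀ i ∈ s, x i ≤ X i) :
    ∑ i ∈ s, X i * negMulLogTwo (x i / X i) ≤
      (∑ i ∈ s, X i) * negMulLogTwo ((∑ i ∈ s, x i) / ∑ i ∈ s, X i) := by
  have hX : ∀ i ∈ s, 0 ≤ X i := fun i hi => (hx i hi).trans (hxX i hi)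
  rcases (Finset.sum_nonneg hX).eq_or_lt with h | h
  · have h0 := (Finset.sum_eq_zero_iff_of_nonneg hX).1 h.symm
    rw [Finset.sum_eq_zero fun i hi => by rw [h0 i hi, zero_mul]]
    simp [← h]
  · have := concaveOn_negMulLogTwo.le_map_sum (t := s) (w := fun i => X i / ∑ i ∈ s, X i)
      (p := fun i => x i / X i) (fun i hi => div_nonneg (hX i hi) h.le)
      (by rw [← Finset.sum_div, div_self h.ne']) (fun i hi => div_nonneg (hx i hi) (hX i hi))
    -- Where `X i = 0`, the bound `x i ≤ X i` forces `x i = 0`, so the default value of division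
    -- does no harm.
    have e : ∀ i ∈ s, (X i / ∑ i ∈ s, X i) • (x i / X i) = x i / ∑ i ∈ s, X i := by
      intro i hi
      rcases eq_or_ne (X i) 0 with h0 | h0
      · have : x i = 0 := le_antisymm (h0 ▸ hxX i hi) (hx i hi)
        simp [h0, this]
      · rw [smul_eq_mul]; field_simp
    rw [Finset.sum_congr rfl e, ← Finset.sum_div] at this
    calc ∑ i ∈ s, X i * negMulLogTwo (x i / X i)
        = (∑ i ∈ s, X i) * ∑ i ∈ s, (X i / ∑ i ∈ s, X i) • negMulLogTwo (x i / X i) := by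
          rw [Finset.mul_sum]
          refine Finset.sum_congr rfl fun i _ => ?_
          rw [smul_eq_mul]; field_simp
      _ ≤ _ := mul_le_mul_of_nonneg_left this h.le

/-- The function `x ↦ ∑ᵢ -xᵢ log₂ (xᵢ / ∑ⱼ xⱼ)` of nonnegative vectors is superadditive. -/
theorem sum_negMulLogTwo_sub_le {ι κ : Type*} [Fintype ι] [Fintype κ] {x : κ → ι → ℝ}
    (hx : ∀ k i, 0 ≤ x k i) :
    ∑ k, (∑ i, negMulLogTwo (x k i) - negMulLogTwo (∑ i, x k i)) ≤
      ∑ i, negMulLogTwo (∑ k, x k i) - negMulLogTwo (∑ i, ∑ k, x k i) := by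
  rw [sum_negMulLogTwo_sub _ fun i _ => Finset.sum_nonneg fun k _ => hx k i]
  simp_rw [sum_negMulLogTwo_sub _ fun i _ => hx _ i]
  rw [Finset.sum_comm]
  refine Finset.sum_le_sum fun i _ => ?_
  rw [Finset.sum_comm (f := fun i k => x k i)]
  exact sum_mul_negMulLogTwo_div_le _ (fun k _ => hx k i)
    fun k _ => Finset.single_le_sum (fun i _ => hx k i) (Finset.mem_univ i)

variable {n : Type*} [Fintype n] [DecidableEq n]

/-- The homogeneous extension `Tr τ · S(τ / Tr τ) = S(τ) + Tr τ log₂ Tr τ` of the entropy to the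
cone of positive semidefinite matrices. -/
noncomputable def weightedEntropy (τ : Matrix n n ℂ) : ℝ :=
  entropy τ - negMulLogTwo τ.trace.re

theorem weightedEntropy_of_trace_eq_one {τ : Matrix n n ℂ} (h : τ.trace = 1) :
    weightedEntropy τ = entropy τ := by
  simp [weightedEntropy, h]

theorem weightedEntropy_smul {τ : Matrix n n ℂ} (hτ : τ.IsHermitian) (t : ℝ) :
    weightedEntropy ((t : ℂ) • τ) = t * weightedEntropy τ := by
  simp only [weightedEntropy, entropy_smul hτ, trace_smul, smul_eq_mul, Complex.re_ofReal_mul,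
    negMulLogTwo_mul]
  ring

@[simp] theorem weightedEntropy_zero : weightedEntropy (0 : Matrix n n ℂ) = 0 := by
  simpa using weightedEntropy_smul (isHermitian_zero (n := n) (α := ℂ)) 0

theorem continuousOn_weightedEntropy :
    ContinuousOn (weightedEntropy (n := n)) {A | A.IsHermitian} :=
  continuousOn_entropy.sub (continuous_negMulLogTwo.comp
    (Complex.continuous_re.comp (continuous_id.matrix_trace))).continuousOn

/-- Concavity of the von Neumann entropy, in homogeneous form. -/
theorem sum_weightedEntropy_le {κ : Type*} [Fintype κ] {τ : κ → Matrix n n ℂ}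
    (hτ : ∀ k, (τ k).PosSemidef) :
    ∑ k, weightedEntropy (τ k) ≤ weightedEntropy (∑ k, τ k) := by
  have hsum : (∑ k, τ k).PosSemidef := posSemidef_sum _ fun k _ => hτ k
  obtain ⟨U, hU, hU', h⟩ := exists_unitary_diagonalization hsum.isHermitian
  set d := hsum.isHermitian.eigenvalues
  -- Diagonals are taken in an eigenbasis of the sum: passing to the diagonal is lossless for the
  -- sum and can only raise the entropy of each summand.
  set x : κ → n → ℝ := fun k i => ((Uᴴ * τ k * U) i i).re
  have hpos : ∀ k, (Uᴴ * τ k * U).PosSemidef := fun k => (hτ k).conjTranspose_mul_mul_same U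
  have hx : ∀ k i, 0 ≤ x k i := fun k i =>
    (Complex.nonneg_iff.1 (hpos k).diag_nonneg).1
  have htr : ∀ A : Matrix n n ℂ, (Uᴴ * A * U).trace = A.trace := fun A => by
    rw [trace_mul_comm, ← mul_assoc, hU', one_mul]
  have hxtr : ∀ k, ∑ i, x k i = (τ k).trace.re := fun k => by
    rw [← htr, trace, Complex.re_sum]; rfl
  have hd : ∀ i, d i = ∑ k, x k i := by
    have : Uᴴ * (∑ k, τ k) * U = diagonal fun i => (d i : ℂ) := by
      rw [h]
      simp only [mul_assoc, hU, mul_one]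
      rw [← mul_assoc, hU, one_mul]
    intro i
    have h1 := congrArg Complex.re (congrFun (congrFun this i) i)
    rw [diagonal_apply_eq, Complex.ofReal_re, Finset.mul_sum, Finset.sum_mul, Matrix.sum_apply,
      Complex.re_sum] at h1
    exact h1.symm
  calc ∑ k, weightedEntropy (τ k)
      ≤ ∑ k, (∑ i, negMulLogTwo (x k i) - negMulLogTwo (∑ i, x k i)) := by
        refine Finset.sum_le_sum fun k _ => ?_
        rw [weightedEntropy, hxtr]
        refine sub_le_sub_right ?_ _
        refine le_trans (le_of_eq ?_) (entropy_le_sum_diag (hpos k))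
        have := entropy_conj (U := Uᴴ) (hτ k).isHermitian (by simpa using hU')
        rw [conjTranspose_conjTranspose] at this
        exact this.symm
    _ ≤ ∑ i, negMulLogTwo (∑ k, x k i) - negMulLogTwo (∑ i, ∑ k, x k i) :=
        sum_negMulLogTwo_sub_le hx
    _ = weightedEntropy (∑ k, τ k) := by
        rw [weightedEntropy, entropy_eq_sum_eigenvalues hsum.isHermitian, trace_sum,
          Complex.re_sum, Finset.sum_comm (f := fun i k => x k i)]
        simp_rw [hxtr, ← hd]
        rfl

end WeightedEntropy

/-! ### Pure states, spectral ensembles, and compactness of the state space -/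

section PureStates

variable {n : Type*}

theorem ketbra_apply (ψ : n → ℂ) (i j : n) : ketbra ψ i j = ψ i * star (ψ j) := rfl

theorem ketbra_smul (c : ℂ) (ψ : n → ℂ) : ketbra (c • ψ) = (c * star c) • ketbra ψ := by
  ext i j
  simp only [ketbra_apply, Pi.smul_apply, smul_eq_mul, star_mul', Matrix.smul_apply]
  ring

variable [Fintype n]

theorem posSemidef_ketbra (ψ : n → ℂ) : (ketbra ψ).PosSemidef :=
  posSemidef_vecMulVec_self_star ψ

theorem trace_ketbra (ψ : n → ℂ) : (ketbra ψ).trace = ((∑ k, ‖ψ k‖ ^ 2 : ℝ) : ℂ) := by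
  simp only [trace, diag_apply, ketbra_apply]
  push_cast
  exact Finset.sum_congr rfl fun k _ => Complex.mul_conj' _

theorem isCompact_unit_ketbra :
    IsCompact (ketbra '' {ψ : n → ℂ | ∑ k, ‖ψ k‖ ^ 2 = 1}) := by
  have hc : IsCompact {ψ : n → ℂ | ∑ k, ‖ψ k‖ ^ 2 = 1} := by
    refine Metric.isCompact_of_isClosed_isBounded
      (isClosed_eq (by fun_prop) continuous_const)
      (Metric.isBounded_closedBall.subset (t := Metric.closedBall 0 1) fun ψ hψ => ?_)
    rw [mem_closedBall_zero_iff, pi_norm_le_iff_of_nonneg zero_le_one]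
    intro k
    have : ‖ψ k‖ ^ 2 ≤ 1 := (Finset.single_le_sum (f := fun k => ‖ψ k‖ ^ 2)
      (fun k _ => by positivity) (Finset.mem_univ k)).trans_eq hψ
    exact (sq_le_one_iff₀ (norm_nonneg _)).1 this
  refine hc.image ?_
  unfold ketbra
  fun_prop

theorem isDensityMatrix_ketbra {ψ : n → ℂ} (hψ : ∑ k, ‖ψ k‖ ^ 2 = 1) :
    IsDensityMatrix (ketbra ψ) :=
  ⟨posSemidef_ketbra ψ, by rw [trace_ketbra, hψ, Complex.ofReal_one]⟩

theorem exists_unit_vector [Nonempty n] : ∃ ψ : n → ℂ, ∑ k, ‖ψ k‖ ^ 2 = 1 := by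
  classical
  obtain ⟨i⟩ := ‹Nonempty n›
  refine ⟨Pi.single i 1, ?_⟩
  rw [Finset.sum_eq_single i (fun j _ hj => by simp [hj]) (by simp)]
  simp

theorem IsDensityMatrix.nonempty {ρ : Matrix n n ℂ} (hρ : IsDensityMatrix ρ) : Nonempty n := by
  by_contra h
  rw [not_nonempty_iff] at h
  simpa [trace] using hρ.trace_eq_one

theorem exists_ketbra_eq_smul [Nonempty n] (φ : n → ℂ) :
    ∃ ψ : n → ℂ, ∑ k, ‖ψ k‖ ^ 2 = 1 ∧
      ketbra φ = (((ketbra φ).trace.re : ℝ) : ℂ) • ketbra ψ := by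
  rw [trace_ketbra, Complex.ofReal_re]
  set s := ∑ k, ‖φ k‖ ^ 2 with hs
  have hs0 : 0 ≤ s := Finset.sum_nonneg fun k _ => by positivity
  rcases hs0.eq_or_lt with h | h
  · obtain ⟨ψ, hψ⟩ := exists_unit_vector (n := n)
    refine ⟨ψ, hψ, ?_⟩
    have h0 : φ = 0 := by
      ext k
      have := (Finset.sum_eq_zero_iff_of_nonneg (fun k _ => by positivity)).1 h.symm k
        (Finset.mem_univ k)
      simpa using this
    rw [← h, h0]
    ext; simp [ketbra_apply]
  · refine ⟨((√s)⁻¹ : ℂ) • φ, ?_, ?_⟩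
    · simp only [Pi.smul_apply, smul_eq_mul, norm_mul, mul_pow, ← Finset.mul_sum, ← hs]
      rw [norm_inv, Complex.norm_real, Real.norm_of_nonneg (Real.sqrt_nonneg s), inv_pow,
        Real.sq_sqrt hs0, inv_mul_cancel₀ h.ne']
    · rw [ketbra_smul, smul_smul]
      have : (s : ℂ) * ((√s : ℂ)⁻¹ * star ((√s : ℂ)⁻¹)) = 1 := by
        rw [← Complex.ofReal_inv, ← starRingEnd_apply, Complex.conj_ofReal, ← Complex.ofReal_mul,
          ← Complex.ofReal_mul, ← mul_inv, Real.mul_self_sqrt hs0, mul_inv_cancel₀ h.ne',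
          Complex.ofReal_one]
      rw [this, one_smul]

/-- The spectral decomposition of a positive semidefinite matrix into pure states. -/
theorem PosSemidef.exists_eq_sum_ketbra [DecidableEq n] {A : Matrix n n ℂ} (hA : A.PosSemidef) :
    ∃ ψ : n → n → ℂ, (∀ i, ∑ k, ‖ψ i k‖ ^ 2 = 1) ∧
      A = ∑ i, ((hA.isHermitian.eigenvalues i : ℝ) : ℂ) • ketbra (ψ i) := by
  obtain ⟨U, hU, -, h⟩ := exists_unitary_diagonalization hA.isHermitian
  refine ⟨fun i k => U k i, fun i => ?_, ?_⟩
  · have := congrFun (congrFun hU i) i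
    simp only [mul_apply, conjTranspose_apply, ← starRingEnd_apply, Complex.conj_mul',
      one_apply_eq] at this
    exact_mod_cast this
  · conv_lhs => rw [h]
    ext i j
    rw [mul_apply, Matrix.sum_apply]
    refine Finset.sum_congr rfl fun k _ => ?_
    rw [mul_diagonal, Matrix.smul_apply, ketbra_apply, conjTranspose_apply, smul_eq_mul]
    ring

theorem PosSemidef.exists_eq_sum_ketbra' {A : Matrix n n ℂ} (hA : A.PosSemidef) :
    ∃ φ : n → n → ℂ, A = ∑ i, ketbra (φ i) := by
  classical
  obtain ⟨ψ, -, h⟩ := PosSemidef.exists_eq_sum_ketbra hA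
  refine ⟨fun i => ((√(hA.isHermitian.eigenvalues i) : ℝ) : ℂ) • ψ i, ?_⟩
  conv_lhs => rw [h]
  refine Finset.sum_congr rfl fun i _ => ?_
  rw [ketbra_smul, ← starRingEnd_apply, Complex.conj_ofReal, ← Complex.ofReal_mul,
    Real.mul_self_sqrt (hA.eigenvalues_nonneg i)]

theorem sum_eigenvalues_of_trace_eq_one [DecidableEq n] {A : Matrix n n ℂ} (hA : A.IsHermitian)
    (h : A.trace = 1) : ∑ i, hA.eigenvalues i = 1 := by
  have := hA.trace_eq_sum_eigenvalues
  rw [h] at this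
  exact Complex.ofReal_injective (by simpa using this.symm)

theorem setOf_isDensityMatrix_eq_convexHull :
    {A : Matrix n n ℂ | IsDensityMatrix A} =
      convexHull ℝ (ketbra '' {ψ : n → ℂ | ∑ k, ‖ψ k‖ ^ 2 = 1}) := by
  classical
  apply Set.Subset.antisymm
  · intro A hA
    obtain ⟨ψ, hψ, h⟩ := PosSemidef.exists_eq_sum_ketbra hA.posSemidef
    refine mem_convexHull_of_exists_fintype _ (fun i => ketbra (ψ i))
      hA.posSemidef.eigenvalues_nonneg
      (sum_eigenvalues_of_trace_eq_one hA.posSemidef.isHermitian hA.trace_eq_one)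
      (fun i => ⟨ψ i, hψ i, rfl⟩) ?_
    conv_rhs => rw [h]
    simp only [Complex.coe_smul]
  · refine convexHull_min ?_ ?_
    · rintro _ ⟨ψ, hψ, rfl⟩
      exact isDensityMatrix_ketbra hψ
    · intro A hA B hB s t hs ht hst
      refine ⟨(hA.posSemidef.smul hs).add (hB.posSemidef.smul ht), ?_⟩
      rw [trace_add, trace_smul, trace_smul, hA.trace_eq_one, hB.trace_eq_one, ← add_smul, hst,
        one_smul]

theorem isCompact_setOf_isDensityMatrix : IsCompact {A : Matrix n n ℂ | IsDensityMatrix A} := by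
  rw [setOf_isDensityMatrix_eq_convexHull]
  exact isCompact_convexHull isCompact_unit_ketbra

theorem exists_isDensityMatrix_eq_smul [Nonempty n] {A : Matrix n n ℂ} (hA : A.PosSemidef) :
    ∃ D : Matrix n n ℂ, IsDensityMatrix D ∧ A = ((A.trace.re : ℝ) : ℂ) • D := by
  have htr : ((A.trace.re : ℝ) : ℂ) = A.trace :=
    (Complex.eq_re_of_ofReal_le (r := 0) (by simpa using hA.trace_nonneg)).symm
  rw [htr]
  rcases eq_or_ne A.trace 0 with h | h
  · obtain ⟨ψ, hψ⟩ := exists_unit_vector (n := n)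
    exact ⟨ketbra ψ, isDensityMatrix_ketbra hψ, by rw [h, zero_smul, hA.trace_eq_zero_iff.1 h]⟩
  · refine ⟨A.trace⁻¹ • A, ⟨hA.smul (inv_nonneg.2 hA.trace_nonneg), ?_⟩, ?_⟩
    · rw [trace_smul, smul_eq_mul, inv_mul_cancel₀ h]
    · rw [smul_smul, mul_inv_cancel₀ h, one_smul]

/-- A pure density matrix is the projector onto a vector. -/
theorem IsDensityMatrix.exists_eq_ketbra {ρ : Matrix n n ℂ} (hρ : IsDensityMatrix ρ)
    (hpure : IsPure ρ) : ∃ ψ : n → ℂ, ρ = ketbra ψ := by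
  classical
  obtain ⟨ψ, -, h⟩ := PosSemidef.exists_eq_sum_ketbra hρ.posSemidef
  obtain ⟨U, hU, -, hU'⟩ := exists_unitary_diagonalization hρ.posSemidef.isHermitian
  set d := hρ.posSemidef.isHermitian.eigenvalues
  have hsum : ∑ i, d i = 1 := sum_eigenvalues_of_trace_eq_one _ hρ.trace_eq_one
  have hd0 : ∀ i, 0 ≤ d i := hρ.posSemidef.eigenvalues_nonneg
  have hdiag : diagonal (fun i => (d i : ℂ)) = Uᴴ * ρ * U := by
    rw [hU']
    simp only [mul_assoc, hU, mul_one]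
    rw [← mul_assoc, hU, one_mul]
  have hsq : diagonal (fun i => (d i : ℂ)) =
      diagonal (fun i => (d i : ℂ)) * diagonal (fun i => (d i : ℂ)) := by
    conv_lhs => rw [hdiag, hpure, hU']
    simp only [mul_assoc, hU, mul_one]
    simp only [← mul_assoc, hU, one_mul]
  -- Purity makes every eigenvalue 0 or 1; since they sum to 1, exactly one is 1.
  have hd : ∀ i, d i = d i * d i := fun i => by
    have := congrFun (congrFun hsq i) i
    simp only [diagonal_mul_diagonal, diagonal_apply_eq] at this
    exact_mod_cast this
  obtain ⟨i, hi⟩ : ∃ i, d i ≠ 0 := by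
    by_contra! h0
    simp [h0] at hsum
  have hi1 : d i = 1 := (mul_right_cancel₀ hi (by rw [one_mul]; exact hd i)).symm
  rw [← Finset.add_sum_erase _ _ (Finset.mem_univ i), hi1, add_eq_left,
    Finset.sum_eq_zero_iff_of_nonneg fun j _ => hd0 j] at hsum
  refine ⟨ψ i, ?_⟩
  rw [h, ← Finset.add_sum_erase _ _ (Finset.mem_univ i), hi1,
    Finset.sum_eq_zero fun j hj => by rw [hsum j hj, Complex.ofReal_zero, zero_smul]]
  simp

end PureStates

/-! ### Partial trace and conditional states -/

section PartialTrace

variable {x y : Type*} [Fintype y]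

theorem traceRight_apply (ρ : Matrix (x × y) (x × y) ℂ) (i j : x) :
    traceRight ρ i j = ∑ k, ρ (i, k) (j, k) := rfl

theorem traceRight_sum {κ : Type*} (s : Finset κ) (ρ : κ → Matrix (x × y) (x × y) ℂ) :
    traceRight (∑ k ∈ s, ρ k) = ∑ k ∈ s, traceRight (ρ k) := by
  ext i j
  simp only [traceRight_apply, Matrix.sum_apply]
  exact Finset.sum_comm

theorem traceRight_smul (c : ℂ) (ρ : Matrix (x × y) (x × y) ℂ) :
    traceRight (c • ρ) = c • traceRight ρ := by
  ext i j
  simp only [traceRight_apply, Matrix.smul_apply, smul_eq_mul, Finset.mul_sum]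

/-- For a state `ρ` of a bipartite system and an effect `M` on the second factor, the unnormalised
state `Tr_Y[(𝕀 ⊗ M) ρ]` of the first factor conditioned on `M`. -/
def steer (ρ : Matrix (x × y) (x × y) ℂ) : Matrix y y ℂ →ₗ[ℂ] Matrix x x ℂ where
  toFun M := Matrix.of fun i j => ∑ k, ∑ l, M k l * ρ (i, l) (j, k)
  map_add' M N := by
    ext i j
    simp only [of_apply, Matrix.add_apply, add_mul, Finset.sum_add_distrib]
  map_smul' c M := by
    ext i j
    simp only [of_apply, Matrix.smul_apply, smul_eq_mul, Finset.mul_sum, mul_assoc,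
      RingHom.id_apply]

theorem steer_apply (ρ : Matrix (x × y) (x × y) ℂ) (M : Matrix y y ℂ) (i j : x) :
    steer ρ M i j = ∑ k, ∑ l, M k l * ρ (i, l) (j, k) := rfl

theorem steer_one [DecidableEq y] (ρ : Matrix (x × y) (x × y) ℂ) : steer ρ 1 = traceRight ρ := by
  ext i j
  simp [steer_apply, traceRight_apply, one_apply]

variable [Fintype x]

theorem trace_traceRight (ρ : Matrix (x × y) (x × y) ℂ) : (traceRight ρ).trace = ρ.trace := by
  simp only [trace, diag_apply, traceRight_apply, Fintype.sum_prod_type]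

theorem steer_eq_traceRight [DecidableEq x] (ρ : Matrix (x × y) (x × y) ℂ) (M : Matrix y y ℂ) :
    traceRight ((1 : Matrix x x ℂ) ⊗ₖ M * ρ) = steer ρ M := by
  ext i j
  simp only [traceRight_apply, steer_apply, mul_apply, Fintype.sum_prod_type, kroneckerMap_apply,
    one_apply, ite_mul, one_mul, zero_mul]
  refine Finset.sum_congr rfl fun k _ => ?_
  rw [Finset.sum_eq_single i (fun i' _ h => by simp [h.symm]) (by simp)]
  simp

theorem posSemidef_steer {ρ : Matrix (x × y) (x × y) ℂ} (hρ : ρ.PosSemidef) {M : Matrix y y ℂ}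
    (hM : M.PosSemidef) : (steer ρ M).PosSemidef := by
  classical
  obtain ⟨φ, rfl⟩ := PosSemidef.exists_eq_sum_ketbra' hM
  rw [map_sum]
  refine posSemidef_sum _ fun r _ => ?_
  -- `X` is 𝕀 ⊗ ⟨φ_r|, so a rank-one effect acts as a congruence by `X`.
  let X : Matrix x (x × y) ℂ := Matrix.of fun i p => if i = p.1 then star (φ r p.2) else 0
  have hX : ∀ i p, X i p = if i = p.1 then star (φ r p.2) else 0 := fun _ _ => rfl
  have : steer ρ (ketbra (φ r)) = X * ρ * Xᴴ := by
    ext i j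
    simp only [steer_apply, mul_apply, Fintype.sum_prod_type, conjTranspose_apply, hX,
      ketbra_apply]
    rw [Finset.sum_eq_single j (fun i' _ h => by simp [h.symm]) (by simp)]
    refine Finset.sum_congr rfl fun k _ => ?_
    rw [Finset.sum_eq_single i (fun i' _ h => by simp [h.symm]) (by simp)]
    simp only [if_true, star_star, Finset.sum_mul]
    exact Finset.sum_congr rfl fun l _ => by ring
  rw [this]
  exact hρ.mul_mul_conjTranspose_same X

theorem posSemidef_traceRight {ρ : Matrix (x × y) (x × y) ℂ} (hρ : ρ.PosSemidef) :
    (traceRight ρ).PosSemidef := by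
  classical
  rw [← steer_one]
  exact posSemidef_steer hρ PosSemidef.one

omit [Fintype x] in
theorem continuous_traceRight :
    Continuous (traceRight : Matrix (x × y) (x × y) ℂ → Matrix x x ℂ) := by
  unfold traceRight
  fun_prop

omit [Fintype x] in
theorem continuous_steer (ρ : Matrix (x × y) (x × y) ℂ) : Continuous (steer ρ) :=
  LinearMap.continuous_of_finiteDimensional _

end PartialTrace

/-! ### Entanglement of formation is attained -/

section Formation

variable {x y : Type*} [Fintype x] [DecidableEq x] [Fintype y]

theorem formationValues_eq_convexAverages (ρ : Matrix (x × y) (x × y) ℂ) :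
    formationValues ρ = convexAverages (ketbra '' {ψ : x × y → ℂ | ∑ k, ‖ψ k‖ ^ 2 = 1})
      (fun A => entropy (traceRight A)) ρ := by
  ext v
  constructor
  · rintro ⟨m, p, ψ, h, rfl⟩
    refine ⟨m, p, fun i => ketbra (ψ i), h.nonneg, h.sum_eq_one,
      fun i => ⟨ψ i, h.normalized i, rfl⟩, ?_, rfl⟩
    simp only [h.realizes, Complex.coe_smul]
  · rintro ⟨m, p, A, hp0, hp1, hA, hsum, rfl⟩
    choose ψ hψ hψA using hA
    obtain rfl : (fun i => ketbra (ψ i)) = A := funext hψA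
    exact ⟨m, p, ψ, ⟨hp0, hp1, hψ, by simp only [← hsum, Complex.coe_smul]⟩, rfl⟩

theorem isCompact_formationValues (ρ : Matrix (x × y) (x × y) ℂ) :
    IsCompact (formationValues ρ) := by
  rw [formationValues_eq_convexAverages]
  refine isCompact_convexAverages isCompact_unit_ketbra ?_ ρ
  refine continuousOn_entropy.comp continuous_traceRight.continuousOn ?_
  rintro _ ⟨ψ, -, rfl⟩
  exact (posSemidef_traceRight (posSemidef_ketbra ψ)).isHermitian

/-- Unnormalised vectors carry their probabilities as squared norms, and homogeneity of
`weightedEntropy` extracts them. A zero vector has weight 0. -/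
theorem sum_weightedEntropy_mem_formationValues {ρ : Matrix (x × y) (x × y) ℂ}
    (hρ : IsDensityMatrix ρ) {κ : Type*} [Fintype κ] {φ : κ → x × y → ℂ}
    (h : ∑ k, ketbra (φ k) = ρ) :
    ∑ k, weightedEntropy (traceRight (ketbra (φ k))) ∈ formationValues ρ := by
  have := hρ.nonempty
  choose ψ hψ hφ using fun k => exists_ketbra_eq_smul (φ k)
  let e := (Fintype.equivFin κ).symm
  refine ⟨Fintype.card κ, fun i => (ketbra (φ (e i))).trace.re, fun i => ψ (e i),
    ⟨fun i => (Complex.nonneg_iff.1 (posSemidef_ketbra _).trace_nonneg).1, ?_,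
      fun i => hψ _, ?_⟩, ?_⟩
  · rw [e.sum_comp fun k => (ketbra (φ k)).trace.re, ← Complex.re_sum, ← trace_sum, h,
      hρ.trace_eq_one, Complex.one_re]
  · rw [e.sum_comp fun k => (((ketbra (φ k)).trace.re : ℝ) : ℂ) • ketbra (ψ k), ← h]
    exact Finset.sum_congr rfl fun k _ => hφ k
  · rw [e.sum_comp fun k => (ketbra (φ k)).trace.re * entanglementEntropy (ψ k)]
    refine Finset.sum_congr rfl fun k _ => ?_
    have htr : (traceRight (ketbra (ψ k))).trace = 1 := by
      rw [trace_traceRight, (isDensityMatrix_ketbra (hψ k)).trace_eq_one]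
    conv_lhs => rw [hφ k]
    rw [traceRight_smul,
      weightedEntropy_smul (posSemidef_traceRight (posSemidef_ketbra _)).isHermitian,
      weightedEntropy_of_trace_eq_one htr]
    rfl

theorem formationValues_nonempty {ρ : Matrix (x × y) (x × y) ℂ} (hρ : IsDensityMatrix ρ) :
    (formationValues ρ).Nonempty := by
  obtain ⟨φ, hφ⟩ := PosSemidef.exists_eq_sum_ketbra' hρ.posSemidef
  exact ⟨_, sum_weightedEntropy_mem_formationValues hρ hφ.symm⟩

theorem isLeast_entanglementOfFormation {ρ : Matrix (x × y) (x × y) ℂ}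
    (hρ : IsDensityMatrix ρ) : IsLeast (formationValues ρ) (entanglementOfFormation ρ) :=
  (isCompact_formationValues ρ).isLeast_sInf (formationValues_nonempty hρ)

end Formation

/-! ### Classical correlations are attained -/

section Measurement

variable {x y : Type*} [Fintype x] [DecidableEq x] [Fintype y]

theorem measureRight_eq_blockDiagonal {m : ℕ} (M : Fin m → Matrix y y ℂ)
    (ρ : Matrix (x × y) (x × y) ℂ) :
    measureRight M ρ = blockDiagonal fun k => steer ρ (M k) := by
  ext ⟨i, k⟩ ⟨j, l⟩
  simp only [measureRight, steer_eq_traceRight, Matrix.sum_apply, kroneckerMap_apply,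
    blockDiagonal_apply, single_apply]
  rw [Finset.sum_eq_single k (fun k' _ h => by simp [h]) (by simp)]
  simp

omit [Fintype x] [DecidableEq x] in
theorem traceRight_blockDiagonal {o : Type*} [Fintype o] [DecidableEq o]
    (τ : o → Matrix x x ℂ) : traceRight (blockDiagonal τ) = ∑ k, τ k := by
  ext i j
  simp [traceRight_apply, blockDiagonal_apply, Matrix.sum_apply]

omit [DecidableEq x] in
theorem traceLeft_blockDiagonal {o : Type*} [DecidableEq o]
    (τ : o → Matrix x x ℂ) : traceLeft (blockDiagonal τ) = diagonal fun k => (τ k).trace := by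
  ext k l
  by_cases h : k = l
  · subst h
    simp [traceLeft, blockDiagonal_apply, trace]
  · simp [traceLeft, blockDiagonal_apply, h]

variable [DecidableEq y]

/-- The register has the Shannon entropy of the outcome probabilities, which is exactly what turns
each block entropy into a `weightedEntropy`. -/
theorem mutualInfo_measureRight {ρ : Matrix (x × y) (x × y) ℂ} (hρ : ρ.PosSemidef) {m : ℕ}
    {M : Fin m → Matrix y y ℂ} (hM : IsPOVM M) :
    mutualInfo (measureRight M ρ) =
      entropy (traceRight ρ) - ∑ k, weightedEntropy (steer ρ (M k)) := by
  have hτ : ∀ k, (steer ρ (M k)).PosSemidef := fun k => posSemidef_steer hρ (hM.posSemidef k)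
  have htr : (fun k => (steer ρ (M k)).trace) = fun k => (((steer ρ (M k)).trace.re : ℝ) : ℂ) :=
    funext fun k => Complex.eq_re_of_ofReal_le (r := 0) (by simpa using (hτ k).trace_nonneg)
  rw [mutualInfo, measureRight_eq_blockDiagonal, traceRight_blockDiagonal,
    traceLeft_blockDiagonal, htr, entropy_diagonal,
    entropy_blockDiagonal fun k => (hτ k).isHermitian, ← map_sum, hM.sum_eq_one, steer_one]
  simp only [weightedEntropy, Finset.sum_sub_distrib]
  ring

/-- Dividing a POVM by d = dim Y gives a convex decomposition of 𝕀/d into density matrices, with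
weights Tr M_k / d, and conversely; homogeneity transfers the values. This trades POVMs of unbounded
size for `convexAverages` over a compact set. -/
theorem measuredInfoValues_eq_image [Nonempty y] {ρ : Matrix (x × y) (x × y) ℂ}
    (hρ : ρ.PosSemidef) :
    measuredInfoValues ρ =
      (fun v => entropy (traceRight ρ) - Fintype.card y * v) ''
        convexAverages {D : Matrix y y ℂ | IsDensityMatrix D}
          (fun D => weightedEntropy (steer ρ D))
          ((Fintype.card y : ℝ)⁻¹ • (1 : Matrix y y ℂ)) := by
  set d : ℝ := (Fintype.card y : ℝ) with hd
  have hd0 : 0 < d := by rw [hd]; exact_mod_cast Fintype.card_pos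
  have hG : ∀ (t : ℝ) {D : Matrix y y ℂ}, D.PosSemidef →
      weightedEntropy (steer ρ ((t : ℂ) • D)) = t * weightedEntropy (steer ρ D) := by
    intro t D hD
    rw [map_smul, weightedEntropy_smul (posSemidef_steer hρ hD).isHermitian]
  ext v
  constructor
  · rintro ⟨m, M, hM, rfl⟩
    choose D hD hMD using fun k => exists_isDensityMatrix_eq_smul (hM.posSemidef k)
    refine ⟨∑ k, (d⁻¹ * (M k).trace.re) * weightedEntropy (steer ρ (D k)),
      ⟨m, fun k => d⁻¹ * (M k).trace.re, D,
        fun k => mul_nonneg (inv_nonneg.2 hd0.le)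
          (Complex.nonneg_iff.1 (hM.posSemidef k).trace_nonneg).1, ?_, hD, ?_, rfl⟩, ?_⟩
    · rw [← Finset.mul_sum, ← Complex.re_sum, ← trace_sum, hM.sum_eq_one, trace_one,
        Complex.natCast_re, inv_mul_cancel₀ hd0.ne']
    · simp_rw [mul_smul, ← Finset.smul_sum, ← Complex.coe_smul (M _).trace.re, ← hMD]
      rw [hM.sum_eq_one]
    · simp only
      rw [mutualInfo_measureRight hρ hM, Finset.mul_sum]
      congr 1
      refine Finset.sum_congr rfl fun k _ => ?_
      conv_rhs => rw [hMD k]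
      rw [hG _ (hD k).posSemidef]
      field_simp
  · rintro ⟨_, ⟨m, w, D, hw0, hw1, hD, hsum, rfl⟩, rfl⟩
    have hM : IsPOVM fun k => ((d * w k : ℝ) : ℂ) • D k := by
      refine ⟨fun k => (hD k).posSemidef.smul ?_, ?_⟩
      · exact_mod_cast mul_nonneg hd0.le (hw0 k)
      · simp_rw [Complex.coe_smul, mul_smul, ← Finset.smul_sum]
        rw [hsum, smul_smul, mul_inv_cancel₀ hd0.ne', one_smul]
    refine ⟨m, _, hM, ?_⟩
    simp only
    rw [mutualInfo_measureRight hρ hM, Finset.mul_sum]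
    congr 1
    refine Finset.sum_congr rfl fun k _ => ?_
    rw [hG _ (hD k).posSemidef, mul_assoc]

theorem isCompact_measuredInfoValues [Nonempty y] {ρ : Matrix (x × y) (x × y) ℂ}
    (hρ : ρ.PosSemidef) : IsCompact (measuredInfoValues ρ) := by
  rw [measuredInfoValues_eq_image hρ]
  refine (isCompact_convexAverages isCompact_setOf_isDensityMatrix ?_ _).image (by fun_prop)
  exact continuousOn_weightedEntropy.comp (continuous_steer ρ).continuousOn
    fun D hD => (posSemidef_steer hρ hD.posSemidef).isHermitian

theorem measuredInfoValues_nonempty (ρ : Matrix (x × y) (x × y) ℂ) :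
    (measuredInfoValues ρ).Nonempty :=
  ⟨_, 1, fun _ => 1, ⟨fun _ => PosSemidef.one, by simp⟩, rfl⟩

theorem isGreatest_classicalCorrelations {ρ : Matrix (x × y) (x × y) ℂ}
    (hρ : IsDensityMatrix ρ) : IsGreatest (measuredInfoValues ρ) (classicalCorrelations ρ) := by
  have : Nonempty y := hρ.nonempty.map Prod.snd
  exact (isCompact_measuredInfoValues hρ.posSemidef).isGreatest_sSup
    (measuredInfoValues_nonempty ρ)

end Measurement

/-! ### The inequality: measurements on C give ensembles of AB -/

section Tripartite

variable {a b c : Type*} [Fintype a] [Fintype b] [Fintype c]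

theorem IsDensityMatrix.submatrix {n m : Type*} [Fintype n] [Fintype m] {ρ : Matrix n n ℂ}
    (hρ : IsDensityMatrix ρ) (e : m ≃ n) : IsDensityMatrix (ρ.submatrix e e) :=
  ⟨hρ.posSemidef.submatrix e, by
    rw [← hρ.trace_eq_one]; exact e.sum_comp fun i => ρ i i⟩

theorem IsDensityMatrix.traceRight {x y : Type*} [Fintype x] [Fintype y]
    {ρ : Matrix (x × y) (x × y) ℂ} (hρ : IsDensityMatrix ρ) : IsDensityMatrix (traceRight ρ) :=
  ⟨posSemidef_traceRight hρ.posSemidef, by rw [trace_traceRight, hρ.trace_eq_one]⟩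

/-- The identification of `A ⊗ (C ⊗ B)`-indices, bracketed as `(A ⊗ C) ⊗ B`, with
`A ⊗ (B ⊗ C)`-indices. -/
def swapAssoc (a b c : Type*) : (a × c) × b ≃ a × b × c :=
  (Equiv.prodAssoc a c b).trans ((Equiv.refl a).prodCongr (Equiv.prodComm c b))

omit [Fintype a] [Fintype b] in
theorem marginalAB_eq_traceRight (ρ : Matrix (a × b × c) (a × b × c) ℂ) :
    marginalAB ρ = traceRight (ρ.submatrix (Equiv.prodAssoc a b c) (Equiv.prodAssoc a b c)) :=
  rfl

omit [Fintype a] [Fintype c] in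
theorem marginalAC_eq_traceRight (ρ : Matrix (a × b × c) (a × b × c) ℂ) :
    marginalAC ρ = traceRight (ρ.submatrix (swapAssoc a b c) (swapAssoc a b c)) :=
  rfl

theorem IsDensityMatrix.marginalAB {ρ : Matrix (a × b × c) (a × b × c) ℂ}
    (hρ : IsDensityMatrix ρ) : IsDensityMatrix (marginalAB ρ) := by
  rw [marginalAB_eq_traceRight]
  exact (hρ.submatrix _).traceRight

theorem IsDensityMatrix.marginalAC {ρ : Matrix (a × b × c) (a × b × c) ℂ}
    (hρ : IsDensityMatrix ρ) : IsDensityMatrix (marginalAC ρ) := by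
  rw [marginalAC_eq_traceRight]
  exact (hρ.submatrix _).traceRight

omit [Fintype a] in
theorem traceRight_marginalAC (ρ : Matrix (a × b × c) (a × b × c) ℂ) :
    traceRight (marginalAC ρ) = marginalA ρ := by
  ext i j
  simp only [traceRight_apply, marginalA, marginalAC, of_apply, Fintype.sum_prod_type]
  exact Finset.sum_comm

-- Measuring C commutes with discarding B.
omit [Fintype a] in
theorem traceRight_steer (ρ : Matrix (a × b × c) (a × b × c) ℂ) (M : Matrix c c ℂ) :
    traceRight (steer (ρ.submatrix (Equiv.prodAssoc a b c) (Equiv.prodAssoc a b c)) M) =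
      steer (marginalAC ρ) M := by
  ext i j
  simp only [traceRight_apply, steer_apply, marginalAC, of_apply, submatrix_apply,
    Equiv.prodAssoc_apply, Finset.mul_sum]
  rw [Finset.sum_comm]
  exact Finset.sum_congr rfl fun k _ => Finset.sum_comm

/-- A measurement on `C` steers `AB` into an ensemble whose average entanglement is at most the
average entropy of the conditional states of `A`. -/
theorem exists_formationValue_le [DecidableEq a] [DecidableEq c]
    {ρ : Matrix (a × b × c) (a × b × c) ℂ} (hρ : IsDensityMatrix ρ) {m : ℕ}
    {M : Fin m → Matrix c c ℂ} (hM : IsPOVM M) :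
    ∃ v ∈ formationValues (marginalAB ρ),
      v ≤ ∑ k, weightedEntropy (steer (marginalAC ρ) (M k)) := by
  set R := ρ.submatrix (Equiv.prodAssoc a b c) (Equiv.prodAssoc a b c) with hR
  have hRd : IsDensityMatrix R := hρ.submatrix _
  choose φ hφ using fun k =>
    PosSemidef.exists_eq_sum_ketbra' (posSemidef_steer hRd.posSemidef (hM.posSemidef k))
  have hsum : ∑ q : Fin m × (a × b), ketbra (φ q.1 q.2) = marginalAB ρ := by
    rw [Fintype.sum_prod_type]
    simp_rw [← hφ]
    rw [← map_sum, hM.sum_eq_one, steer_one, marginalAB_eq_traceRight]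
  refine ⟨_, sum_weightedEntropy_mem_formationValues hρ.marginalAB hsum, ?_⟩
  rw [Fintype.sum_prod_type]
  refine Finset.sum_le_sum fun k _ => ?_
  rw [← traceRight_steer, ← hR, hφ k, traceRight_sum]
  exact sum_weightedEntropy_le fun j => posSemidef_traceRight (posSemidef_ketbra _)

end Tripartite

/-! ### Decompositions of T Tᴴ from resolutions of the identity -/

section Purification

variable {n m : Type*} [Fintype n] [Fintype m]

/-- A Moore–Penrose inverse of a positive semidefinite matrix. -/
theorem PosSemidef.exists_pseudoinverse {A : Matrix n n ℂ} (hA : A.PosSemidef) :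
    ∃ K : Matrix n n ℂ, K.PosSemidef ∧ A * K = K * A ∧ A * K * A = A ∧ K * A * K = K := by
  classical
  obtain ⟨U, hU, -, h⟩ := exists_unitary_diagonalization hA.isHermitian
  set d := hA.isHermitian.eigenvalues
  have hmul : ∀ f g : n → ℂ, U * diagonal f * Uᴴ * (U * diagonal g * Uᴴ) =
      U * diagonal (fun i => f i * g i) * Uᴴ := fun f g => by
    rw [← diagonal_mul_diagonal]
    simp only [mul_assoc]
    rw [← mul_assoc Uᴴ, hU, one_mul]
  -- The convention `0⁻¹ = 0` makes this vanish on the kernel of `A`.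
  refine ⟨U * diagonal (fun i => (d i : ℂ)⁻¹) * Uᴴ, ?_, ?_, ?_, ?_⟩
  · refine PosSemidef.mul_mul_conjTranspose_same (posSemidef_diagonal_iff.2 fun i => ?_) U
    have := inv_nonneg.2 (hA.eigenvalues_nonneg i)
    exact_mod_cast this
  all_goals
    rw [h]
    simp only [hmul]
    congr 3
    funext i
    first
      | exact mul_comm _ _
      | exact mul_inv_mul_cancel _
      | (rcases eq_or_ne (d i : ℂ) 0 with h0 | h0 <;> simp [h0])

theorem PosSemidef.eq_zero_of_sum_eq_zero {κ : Type*} [Fintype κ] {A : κ → Matrix n n ℂ}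
    (hA : ∀ k, (A k).PosSemidef) (h : ∑ k, A k = 0) (k : κ) : A k = 0 := by
  rw [← (hA k).trace_eq_zero_iff]
  have h1 := congrArg trace h
  rw [trace_sum, trace_zero, Finset.sum_eq_zero_iff_of_nonneg fun k _ => (hA k).trace_nonneg] at h1
  exact h1 k (Finset.mem_univ k)

open scoped MatrixOrder Matrix.Norms.L2Operator in
theorem PosSemidef.mul_eq_zero_of_conj_eq_zero {A B : Matrix n n ℂ} (hA : A.PosSemidef)
    (h : Bᴴ * A * B = 0) : A * B = 0 := by
  classical
  obtain ⟨N, hN⟩ := CStarAlgebra.nonneg_iff_eq_star_mul_self.1 hA.nonneg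
  rw [star_eq_conjTranspose] at hN
  subst hN
  have : (N * B)ᴴ * (N * B) = 0 := by
    rw [conjTranspose_mul, ← h]
    simp only [mul_assoc]
  rw [mul_assoc, conjTranspose_mul_self_eq_zero.1 this, mul_zero]

/-- Every decomposition of `T Tᴴ` into positive semidefinite matrices is induced by a resolution of
the identity on the domain of `T`. -/
theorem exists_resolution_of_sum_eq [DecidableEq m] {N : ℕ} (T : Matrix n m ℂ)
    {ω : Fin N → Matrix n n ℂ} (hω : ∀ i, (ω i).PosSemidef) (hsum : ∑ i, ω i = T * Tᴴ) :
    ∃ M : Fin (N + 1) → Matrix m m ℂ, (∀ i, (M i).PosSemidef) ∧ ∑ i, M i = 1 ∧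
      T * M 0 * Tᴴ = 0 ∧ ∀ i : Fin N, T * M i.succ * Tᴴ = ω i := by
  classical
  have hσ : (T * Tᴴ).PosSemidef := posSemidef_self_mul_conjTranspose T
  obtain ⟨K, hK, hcomm, hσK, hKσ⟩ := PosSemidef.exists_pseudoinverse hσ
  set σ := T * Tᴴ with hσdef
  have hKH : Kᴴ = K := hK.isHermitian
  have hσH : σᴴ = σ := hσ.isHermitian
  -- `1 - σ * K` projects onto ker σ. The compressions of the `ω i` to it are positive semidefinite
  -- with sum zero, so each vanishes.
  have hzero : ∀ i, ω i * (1 - σ * K) = 0 := fun i => by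
    refine PosSemidef.mul_eq_zero_of_conj_eq_zero (hω i) ?_
    refine PosSemidef.eq_zero_of_sum_eq_zero (A := fun i => (1 - σ * K)ᴴ * ω i * (1 - σ * K))
      (fun i => (hω i).conjTranspose_mul_mul_same _) ?_ i
    rw [← Finset.sum_mul, ← Finset.mul_sum, hsum, mul_assoc, mul_sub, mul_one, hcomm,
      ← mul_assoc, hσK, sub_self, mul_zero]
  have hright : ∀ i, ω i * (σ * K) = ω i := fun i => by
    have := hzero i
    rw [mul_sub, mul_one, sub_eq_zero] at this
    exact this.symm
  have hleft : ∀ i, σ * K * ω i = ω i := fun i => by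
    have := congrArg conjTranspose (hright i)
    rwa [conjTranspose_mul, (hω i).isHermitian.eq, conjTranspose_mul, hKH, hσH, ← hcomm] at this
  set P := Tᴴ * K * T with hP
  have hPH : Pᴴ = P := by
    rw [hP, conjTranspose_mul, conjTranspose_mul, conjTranspose_conjTranspose, hKH, Matrix.mul_assoc]
  have hPP : P * P = P := by
    calc P * P = Tᴴ * (K * (T * Tᴴ) * K) * T := by simp only [hP, Matrix.mul_assoc]
      _ = P := by rw [← hσdef, hKσ]
  -- Pulling `ω i` back through the pseudoinverse gives effects summing to `P`, the projection onto
  -- the range of Tᴴ. The extra outcome 0 completes them on ker T, where T sees nothing.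
  refine ⟨Fin.cons (1 - P) fun i => Tᴴ * K * ω i * (Tᴴ * K)ᴴ, ?_, ?_, ?_, ?_⟩
  · refine Fin.cases ?_ fun i => ?_
    · rw [Fin.cons_zero]
      have : 1 - P = (1 - P)ᴴ * (1 - P) := by
        rw [conjTranspose_sub, conjTranspose_one, hPH, sub_mul, mul_sub, mul_sub, hPP]
        simp
      rw [this]
      exact posSemidef_conjTranspose_mul_self _
    · rw [Fin.cons_succ]
      exact (hω i).mul_mul_conjTranspose_same _
  · rw [Fin.sum_univ_succ]
    simp only [Fin.cons_zero, Fin.cons_succ]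
    rw [← Matrix.sum_mul, ← Matrix.mul_sum, hsum, conjTranspose_mul, hKH,
      conjTranspose_conjTranspose]
    have : Tᴴ * K * σ * (K * T) = P := by
      calc Tᴴ * K * σ * (K * T) = Tᴴ * (K * σ * K) * T := by simp only [Matrix.mul_assoc]
        _ = P := by rw [hKσ]
    rw [this, sub_add_cancel]
  · rw [Fin.cons_zero, Matrix.mul_sub, Matrix.sub_mul, Matrix.mul_one]
    have : T * P * Tᴴ = σ := by
      calc T * P * Tᴴ = σ * K * σ := by simp only [hP, hσdef, Matrix.mul_assoc]
        _ = σ := hσK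
    rw [this, sub_self]
  · intro i
    rw [Fin.cons_succ]
    calc T * (Tᴴ * K * ω i * (Tᴴ * K)ᴴ) * Tᴴ
        = σ * K * ω i * (K * σ) := by
          simp only [conjTranspose_mul, hKH, conjTranspose_conjTranspose, hσdef, Matrix.mul_assoc]
      _ = ω i := by rw [hleft, ← hcomm, hright]

end Purification

/-! ### Pure states: ensembles of AB give measurements on C -/

section Pure

variable {a b c : Type*} [Fintype a] [Fintype b] [Fintype c]

omit [Fintype a] [Fintype b] in
theorem steer_ketbra (Ψ : a × b × c → ℂ) (M : Matrix c c ℂ) :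
    steer ((ketbra Ψ).submatrix (Equiv.prodAssoc a b c) (Equiv.prodAssoc a b c)) M =
      (Matrix.of fun (i : a × b) k => Ψ (i.1, i.2, k)) * Mᵀ *
        (Matrix.of fun (i : a × b) k => Ψ (i.1, i.2, k))ᴴ := by
  ext i j
  simp only [steer_apply, submatrix_apply, Equiv.prodAssoc_apply, ketbra_apply, mul_apply,
    of_apply, transpose_apply, conjTranspose_apply, Finset.sum_mul]
  exact Finset.sum_congr rfl fun k _ => Finset.sum_congr rfl fun l _ => by ring

/-- If `ABC` is in a pure state, every ensemble of `AB` is steered by a measurement on `C`. -/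
theorem exists_povm_of_mem_formationValues [DecidableEq a] [DecidableEq c]
    {Ψ : a × b × c → ℂ} {v : ℝ} (hv : v ∈ formationValues (marginalAB (ketbra Ψ))) :
    ∃ (m : ℕ) (M : Fin m → Matrix c c ℂ), IsPOVM M ∧
      v = ∑ k, weightedEntropy (steer (marginalAC (ketbra Ψ)) (M k)) := by
  obtain ⟨N, p, ψ, hens, rfl⟩ := hv
  set T : Matrix (a × b) c ℂ := Matrix.of fun i k => Ψ (i.1, i.2, k) with hT
  have hsum : ∑ i, (p i : ℂ) • ketbra (ψ i) = T * Tᴴ := by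
    rw [← hens.realizes, marginalAB_eq_traceRight, ← steer_one, steer_ketbra, transpose_one,
      Matrix.mul_one]
  have hpos : ∀ i, ((p i : ℂ) • ketbra (ψ i)).PosSemidef := fun i =>
    (posSemidef_ketbra _).smul (by exact_mod_cast hens.nonneg i)
  obtain ⟨M, hM, hM1, hM0, hMs⟩ := exists_resolution_of_sum_eq T hpos hsum
  -- The transposes cancel the one in `steer_ketbra`.
  refine ⟨N + 1, fun k => (M k)ᵀ, ⟨fun k => (hM k).transpose, ?_⟩, ?_⟩
  · rw [← transpose_sum, hM1, transpose_one]
  · simp_rw [← traceRight_steer, steer_ketbra, transpose_transpose]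
    rw [Fin.sum_univ_succ, ← hT, hM0]
    have h0 : traceRight (0 : Matrix (a × b) (a × b) ℂ) = 0 := by
      simpa using traceRight_smul 0 (0 : Matrix (a × b) (a × b) ℂ)
    rw [h0, weightedEntropy_zero, zero_add]
    refine Finset.sum_congr rfl fun i _ => ?_
    have htr : (traceRight (ketbra (ψ i))).trace = 1 := by
      rw [trace_traceRight, (isDensityMatrix_ketbra (hens.normalized i)).trace_eq_one]
    rw [hMs, traceRight_smul,
      weightedEntropy_smul (posSemidef_traceRight (posSemidef_ketbra _)).isHermitian,
      weightedEntropy_of_trace_eq_one htr]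
    rfl

end Pure

end QInfo

/-! ### The Koashi–Winter relation -/

theorem mainTheorem2 {a b c : Type*} [Fintype a] [DecidableEq a] [Fintype b]
    [Fintype c] [DecidableEq c] (ρ : Matrix (a × b × c) (a × b × c) ℂ)
    (hρ : QInfo.IsDensityMatrix ρ) :
    IsLeast (QInfo.formationValues (QInfo.marginalAB ρ))
        (QInfo.entanglementOfFormation (QInfo.marginalAB ρ)) ∧
      IsGreatest (QInfo.measuredInfoValues (QInfo.marginalAC ρ))
        (QInfo.classicalCorrelations (QInfo.marginalAC ρ)) ∧
      QInfo.entanglementOfFormation (QInfo.marginalAB ρ) +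
          QInfo.classicalCorrelations (QInfo.marginalAC ρ) ≤
        QInfo.entropy (QInfo.marginalA ρ) ∧
      (QInfo.IsPure ρ →
        QInfo.entanglementOfFormation (QInfo.marginalAB ρ) +
            QInfo.classicalCorrelations (QInfo.marginalAC ρ) =
          QInfo.entropy (QInfo.marginalA ρ)) := by
  have hAC := hρ.marginalAC
  have hE := QInfo.isLeast_entanglementOfFormation hρ.marginalAB
  have hJ := QInfo.isGreatest_classicalCorrelations hAC
  have hle : QInfo.entanglementOfFormation (QInfo.marginalAB ρ) +
      QInfo.classicalCorrelations (QInfo.marginalAC ρ) ≤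
        QInfo.entropy (QInfo.marginalA ρ) := by
    obtain ⟨m, M, hM, hval⟩ := hJ.1
    obtain ⟨v, hv, hvle⟩ := QInfo.exists_formationValue_le hρ hM
    have := hE.2 hv
    rw [hval, QInfo.mutualInfo_measureRight hAC.posSemidef hM, QInfo.traceRight_marginalAC]
    linarith
  refine ⟨hE, hJ, hle, fun hpure => le_antisymm hle ?_⟩
  obtain ⟨Ψ, rfl⟩ := hρ.exists_eq_ketbra hpure
  obtain ⟨m, M, hM, hval⟩ := QInfo.exists_povm_of_mem_formationValues hE.1
  have := hJ.2 ⟨m, M, hM, rfl⟩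
  rw [QInfo.mutualInfo_measureRight hAC.posSemidef hM, QInfo.traceRight_marginalAC, ← hval] at this
  linarith
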